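/- Let $T$ be (the vertex set of) a rooted tree with root $x_0$. For $n\ge 0$ let $T_n$ be the set of vertices at level $n$ (so $T_0=\{x_0\}$), and for $x\in T$ let $S(x)$ be the set of children of $x$. Assume that every $T_n$ is finite and that every $S(x)$ has at least two elements. Let $\mathbb F$ be a field with a Hausdorff topology for which addition and inversion ($a\mapsto a^{-1}$ on $\mathbb F\setminus\{0\}$) are continuous, and let $E$ be a separable (not necessarily complete) topological vector space over $\mathbb F$ whose topology is induced by a translation invariant metric $d$. For $x\in T$ and $y\in S(x)$ let $w(x,y)\in\mathbb F\setminus\{0\}$ be given, and let $q(x,y)\ge 0$ ($x,y\in T$) be real numbers with $q(x,y)>0$ if and only if $y\in S(x)$, and $\sum_{y\in S(x)}q(x,y)=1$ for all $x\in T$. Let $\partial T$ be the set of all infinite paths $e=(z_n)_{n\ge 0}$ with $z_0=x_0$ and $z_{n+1}\in S(z_n)$ for all $n$. For $x\in T$ put $B_x=\{e\in\partial T: e \text{ passes through } x\}$, let $\mathcal M$ be the $\sigma$-algebra on $\partial T$ generated by the sets $B_x$, and let $\mathbb P$ be the unique probability measure on $\mathcal M$ such that $\mathbb P(B_x)=\prod_{j=0}^{n-1}q(y_j,y_{j+1})$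 whenever $x_0=y_0,y_1,\dots,y_n=x$ is the path from the root to $x$. Let $L^0(\partial T,E)$ be the space of $\mathcal M$-measurable functions $\partial T\to E$, modulo $\mathbb P$-almost everywhere equality, with the metric of convergence in probability $$d_{\mathbb P}(h,g)=\int_{\partial T}\frac{d(h(e),g(e))}{1+d(h(e),g(e))}\,d\mathbb P(e).$$ Let $H(T,E)$ be the vector space of generalized harmonic functions, that is, of all $f:T\to E$ with $f(x)=\sum_{y\in S(x)}w(x,y)f(y)$ for all $x\in T$, with the topology inherited from the product topology on $E^T$. For $f\in H(T,E)$ and $n\ge 0$ let $\omega_n(f)\in L^0(\partial T,E)$ be given by $\omega_n(f)(e)=f(z_n)$ for $e=(z_m)_{m\ge 0}$. For an infinite set $\tau=\{n_0<n_1<n_2<\cdots\}\subset\{0,1,2,\dots\}$ let $U_{FM}^\tau(T,E)$ be the set of all $f\in H(T,E)$ such that for every non-empty open set $V\subset L^0(\partial T,E)$ the set $A_V=\{k\ge 0:\omega_{n_k}(f)\in V\}$ has strictly positive lower density, that is, $\liminf_{n\to\infty}\frac1n\#\{k<n:k\in A_V\}>0$. Theorem 5.4. Assume in addition that $\sum_{y\in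 S(x)}w(x,y)=1$ in $\mathbb F$ for all $x\in T$. Then, for every infinite set $\tau\subset\{0,1,2,\dots\}$, the set $U_{FM}^\tau(T,E)\cup\{0\}$ contains a vector subspace of $H(T,E)$ that is dense in $H(T,E)$. -/

import Mathlib

open MeasureTheory Filter Topology
open scoped ENNReal NNReal

namespace HarmonicTree

universe u

section Tree

/-- The set `S(x)` of children of a vertex `x` of a rooted tree. -/
def children {T : RootedTree.{u}} (x : T) : Set T := {y | x ⋖ y}

/-- The set `T_n` of vertices at the `n`-th level; the root is `⊥`. -/
def level (T : RootedTree.{u}) : ℕ → Set T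
  | 0 => {⊥}
  | n + 1 => {y | ∃ x ∈ level T n, y ∈ children x}

/-- All levels are finite and every vertex has at least two children. -/
class Branching (T : RootedTree.{u}) : Prop where
  finite_level : ∀ n, (level T n).Finite
  two_le_children : ∀ x : T, 2 ≤ (children x).encard

variable {T : RootedTree.{u}}

theorem exists_mem_level (x : T) : ∃ n, x ∈ level T n := by
  obtain ⟨n, hn⟩ := (bot_le (a := x)).exists_pred_iterate
  induction n generalizing x with
  | zero => exact ⟨0, hn⟩
  | succ n ih =>
    by_cases hx : x = ⊥
    · exact ⟨0, hx⟩
    · obtain ⟨m, hm⟩ := ih (Order.pred x) hn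
      exact ⟨m + 1, Order.pred x, hm,
        Order.pred_covBy_of_not_isMin (by rwa [isMin_iff_eq_bot])⟩

theorem finite_children [Branching T] (x : T) : (children x).Finite := by
  obtain ⟨n, hn⟩ := exists_mem_level x
  exact (Branching.finite_level (n + 1)).subset fun y hy => ⟨x, hn, hy⟩

noncomputable instance [Branching T] (x : T) : Fintype (children x) :=
  (finite_children x).fintype

instance [Branching T] (x : T) : Nonempty (children x) := by
  rw [Set.nonempty_coe_sort, ← Set.encard_pos]
  exact lt_of_lt_of_le (by norm_num) (Branching.two_le_children x)

instance [Branching T] : Countable T := by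
  have h : (⋃ n, level T n).Countable :=
    Set.countable_iUnion fun n => (Branching.finite_level n).countable
  have h' : (⋃ n, level T n) = Set.univ :=
    Set.eq_univ_of_forall fun x => Set.mem_iUnion.2 (exists_mem_level x)
  rw [h'] at h
  exact Set.countable_univ_iff.1 h

end Tree

section Boundary

/-- The boundary `∂T`: the infinite geodesics `(z_n)` starting at the root. -/
def Boundary (T : RootedTree.{u}) : Type u :=
  {z : ℕ → T // z 0 = ⊥ ∧ ∀ n, z (n + 1) ∈ children (z n)}

variable {T : RootedTree.{u}}

/-- `e n` is the vertex of the geodesic `e` at level `n`. -/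
instance : CoeFun (Boundary T) (fun _ => ℕ → T) := ⟨Subtype.val⟩

/-- The boundary sector `B_x`: all geodesics through `x`. -/
def sector (x : T) : Set (Boundary T) := {e | ∃ n, e n = x}

/-- The `σ`-algebra on `∂T` generated by the boundary sectors. -/
instance : MeasurableSpace (Boundary T) := MeasurableSpace.generateFrom (Set.range sector)

/-- Probability weights `q(x,y) ≥ 0`, positive exactly when `y` is a child of `x`,
with `∑_{y ∈ S(x)} q(x,y) = 1`. -/
structure Transition (T : RootedTree.{u}) [Branching T] where
  prob : T → T → ℝ≥0
  pos_iff : ∀ x y, 0 < prob x y ↔ y ∈ children x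
  sum_eq_one : ∀ x, ∑ y : children x, prob x y = 1

theorem eq_of_apply_eq (e e' : Boundary T) :
    ∀ n m, e n = e' m → n = m ∧ ∀ k ≤ n, e k = e' k := by
  have hb : ∀ (e : Boundary T) n, e (n + 1) ≠ ⊥ := fun e n h => by
    have := (e.2.2 n).lt
    rw [h] at this
    exact not_lt_bot this
  intro n
  induction n with
  | zero =>
    intro m h
    cases m with
    | zero => exact ⟨rfl, fun k hk => by rw [Nat.le_zero.1 hk, h]⟩
    | succ m => exact absurd (h.symm.trans e.2.1) (hb e' m)
  | succ n ih =>
    intro m h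
    cases m with
    | zero => exact absurd (h.trans e'.2.1) (hb e n)
    | succ m =>
      have h2 : e n = e' m := by
        rw [← Order.pred_eq_of_covBy (e.2.2 n), ← Order.pred_eq_of_covBy (e'.2.2 m), h]
      obtain ⟨rfl, h3⟩ := ih m h2
      refine ⟨rfl, fun k hk => ?_⟩
      rcases Nat.le_succ_iff.1 hk with hk | rfl
      · exact h3 k hk
      · exact h

theorem mem_sector_apply (e e' : Boundary T) (n : ℕ) :
    e' ∈ sector (e n) ↔ e' n = e n := by
  refine ⟨?_, fun h => ⟨n, h⟩⟩
  rintro ⟨m, hm⟩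
  obtain ⟨rfl, -⟩ := eq_of_apply_eq e' e m n hm
  exact hm

/-- The geodesic that follows a given choice of a child at every vertex. -/
def choicePath (c : ∀ x : T, children x) : Boundary T :=
  ⟨fun n => Nat.rec ⊥ (fun _ x => (c x : T)) n, rfl, fun _ => (c _).2⟩

theorem choicePath_succ (c : ∀ x : T, children x) (n : ℕ) :
    choicePath c (n + 1) = c (choicePath c n) := rfl

theorem exists_choicePath [Branching T] (n : ℕ) (x : T) (hx : x ∈ level T n) :
    ∃ c : ∀ x : T, children x, choicePath c n = x := by
  classical
  induction n generalizing x with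
  | zero => exact ⟨fun x => Classical.arbitrary _, hx.symm⟩
  | succ n ih =>
    obtain ⟨z, hz, hzx⟩ := hx
    obtain ⟨c, hc⟩ := ih z hz
    have key : ∀ k ≤ n, choicePath (Function.update c z ⟨x, hzx⟩) k = choicePath c k := by
      intro k
      induction k with
      | zero => intro _; rfl
      | succ k ihk =>
        intro hk
        have hne : choicePath c k ≠ z := fun h => by
          have := (eq_of_apply_eq (choicePath c) (choicePath c) k n (h.trans hc.symm)).1
          omega
        rw [choicePath_succ, choicePath_succ, ihk (by omega), Function.update_of_ne hne]
    refine ⟨Function.update c z ⟨x, hzx⟩, ?_⟩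
    rw [choicePath_succ, key n le_rfl, hc, Function.update_self]

/-- Every vertex lies on an infinite geodesic. -/
theorem exists_boundary_apply_eq [Branching T] (x : T) :
    ∃ (e : Boundary T) (n : ℕ), e n = x := by
  obtain ⟨n, hn⟩ := exists_mem_level x
  obtain ⟨c, hc⟩ := exists_choicePath n x hn
  exact ⟨choicePath c, n, hc⟩

theorem measurableSet_sector (x : T) : MeasurableSet (sector x) :=
  MeasurableSpace.measurableSet_generateFrom ⟨x, rfl⟩

theorem sector_bot : sector (⊥ : T) = Set.univ :=
  Set.eq_univ_of_forall fun e => ⟨0, e.2.1⟩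

theorem isPiSystem_sector : IsPiSystem (Set.range (sector : T → Set (Boundary T))) := by
  have key : ∀ (e : Boundary T) (n m : ℕ), n ≤ m → sector (e m) ⊆ sector (e n) := by
    intro e n m hnm e' he'
    rw [mem_sector_apply] at he' ⊢
    exact (eq_of_apply_eq e' e m m he').2 n hnm
  rintro _ ⟨x, rfl⟩ _ ⟨y, rfl⟩ ⟨e, ⟨n, rfl⟩, ⟨m, rfl⟩⟩
  rcases le_total n m with h | h
  · exact ⟨e m, (Set.inter_eq_right.2 (key e n m h)).symm⟩
  · exact ⟨e n, (Set.inter_eq_left.2 (key e m n h)).symm⟩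

section Existence

variable [Branching T]

local instance (x : T) : MeasurableSpace (children x) := ⊤

/-- The law of one step of the random walk from `x`. -/
noncomputable def stepMeasure (q : Transition T) (x : T) : Measure (children x) :=
  ∑ y : children x, (q.prob x y : ℝ≥0∞) • Measure.dirac y

instance (q : Transition T) (x : T) : IsProbabilityMeasure (stepMeasure q x) := by
  constructor
  have := congrArg (fun r : ℝ≥0 => (r : ℝ≥0∞)) (q.sum_eq_one x)
  simpa [stepMeasure] using this

theorem stepMeasure_singleton (q : Transition T) (x : T) (y : children x) :
    stepMeasure q x {y} = q.prob x y := by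
  classical
  simp only [stepMeasure, Measure.finsetSum_apply, Measure.smul_apply, smul_eq_mul]
  rw [Finset.sum_eq_single y]
  · simp
  · intro z _ hz
    rw [Measure.dirac_apply' _ (MeasurableSpace.measurableSet_top)]
    simp [hz]
  · simp

theorem choicePath_preimage_sector [DecidableEq T] (e : Boundary T) (n : ℕ) :
    choicePath ⁻¹' sector (e n) =
      Set.pi (((Finset.range n).image e : Finset T) : Set T)
        (fun x => {y : children x | ∃ k < n, e k = x ∧ (y : T) = e (k + 1)}) := by
  ext c
  simp only [Set.mem_preimage, mem_sector_apply, Set.mem_pi, Finset.coe_image, Set.mem_image,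
    Finset.coe_range, Set.mem_Iio, Set.mem_ofPred_eq]
  constructor
  · rintro h x ⟨k, hk, rfl⟩
    have h' := (eq_of_apply_eq (choicePath c) e n n h).2
    refine ⟨k, hk, rfl, ?_⟩
    have h1 := h' (k + 1) hk
    rw [choicePath_succ] at h1
    rw [← h' k hk.le] at *
    exact h1
  · intro h
    have key : ∀ k ≤ n, choicePath c k = e k := by
      intro k
      induction k with
      | zero => intro _; exact (e.2.1).symm
      | succ k ih =>
        intro hk
        obtain ⟨j, hj, hjk, hc⟩ := h (e k) ⟨k, hk, rfl⟩
        obtain ⟨rfl, -⟩ := eq_of_apply_eq e e j k hjk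
        rw [choicePath_succ, ih (by omega)]
        exact hc
    exact key n le_rfl

theorem exists_boundaryMeasure (q : Transition T) :
    ∃ P : Measure (Boundary T), ∀ (e : Boundary T) (n : ℕ),
      P (sector (e n)) = ∏ j ∈ Finset.range n, (q.prob (e j) (e (j + 1)) : ℝ≥0∞) := by
  classical
  have hm : Measurable (choicePath : (∀ x : T, children x) → Boundary T) := by
    refine measurable_generateFrom ?_
    rintro _ ⟨x, rfl⟩
    obtain ⟨e, n, rfl⟩ := exists_boundary_apply_eq x
    rw [choicePath_preimage_sector]
    exact MeasurableSet.pi (Finset.countable_toSet _)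
      fun _ _ => MeasurableSpace.measurableSet_top
  refine ⟨(Measure.infinitePi (stepMeasure q)).map choicePath, fun e n => ?_⟩
  rw [Measure.map_apply hm (measurableSet_sector _), choicePath_preimage_sector,
    Measure.infinitePi_pi _ (fun _ _ => MeasurableSpace.measurableSet_top), Finset.prod_image]
  · refine Finset.prod_congr rfl fun j hj => ?_
    rw [← stepMeasure_singleton q (e j) ⟨e (j + 1), e.2.2 j⟩]
    congr 1
    ext y
    simp only [Set.mem_ofPred_eq, Set.mem_singleton_iff]
    constructor
    · rintro ⟨k, -, hk, hy⟩
      obtain ⟨rfl, -⟩ := eq_of_apply_eq e e k j hk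
      exact Subtype.ext hy
    · rintro rfl
      exact ⟨j, Finset.mem_range.1 hj, rfl, rfl⟩
  · intro i _ j _ hij
    exact (eq_of_apply_eq e e i j hij).1

theorem existsUnique_boundaryMeasure (q : Transition T) :
    ∃! P : Measure (Boundary T), ∀ (e : Boundary T) (n : ℕ),
      P (sector (e n)) = ∏ j ∈ Finset.range n, (q.prob (e j) (e (j + 1)) : ℝ≥0∞) := by
  obtain ⟨P, hP⟩ := exists_boundaryMeasure q
  refine ⟨P, hP, fun P' hP' => ?_⟩
  have h1 : ∀ Q : Measure (Boundary T), (∀ (e : Boundary T) (n : ℕ),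
      Q (sector (e n)) = ∏ j ∈ Finset.range n, (q.prob (e j) (e (j + 1)) : ℝ≥0∞)) →
      Q Set.univ = 1 := by
    intro Q hQ
    obtain ⟨e, -, -⟩ := exists_boundary_apply_eq (⊥ : T)
    have := hQ e 0
    rwa [e.2.1, sector_bot, Finset.prod_range_zero] at this
  have : IsFiniteMeasure P' := ⟨by rw [h1 P' hP']; exact ENNReal.one_lt_top⟩
  refine ext_of_generate_finite _ rfl isPiSystem_sector ?_ ((h1 P' hP').trans (h1 P hP).symm)
  rintro _ ⟨x, rfl⟩
  obtain ⟨e, n, rfl⟩ := exists_boundary_apply_eq x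
  rw [hP, hP']

/-- The probability measure `ℙ` on `∂T`: the unique measure such that
`ℙ(B_x) = ∏_{j<n} q(y_j, y_{j+1})` for every path `⊥ = y_0, …, y_n = x` down the tree. -/
noncomputable def boundaryMeasure (q : Transition T) : Measure (Boundary T) :=
  (existsUnique_boundaryMeasure q).choose

theorem boundaryMeasure_sector (q : Transition T) (e : Boundary T) (n : ℕ) :
    boundaryMeasure q (sector (e n)) =
      ∏ j ∈ Finset.range n, (q.prob (e j) (e (j + 1)) : ℝ≥0∞) :=
  (existsUnique_boundaryMeasure q).choose_spec.1 e n

instance (q : Transition T) : IsProbabilityMeasure (boundaryMeasure q) := by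
  constructor
  obtain ⟨e, -, -⟩ := exists_boundary_apply_eq (⊥ : T)
  have := boundaryMeasure_sector q e 0
  rwa [e.2.1, sector_bot, Finset.prod_range_zero] at this

end Existence

end Boundary

section LZero

variable {Ω : Type*} [MeasurableSpace Ω]

/-- The space `L⁰` of measurable `E`-valued functions modulo almost everywhere equality.
(For separable metrizable `E`, measurable and strongly measurable functions agree.) -/
def LZero (P : Measure Ω) (E : Type*) [TopologicalSpace E] : Type _ := Ω →ₘ[P] E

variable {P : Measure Ω} [IsFiniteMeasure P] {E : Type*} [MetricSpace E]

theorem integrable_dist_div (f g : Ω →ₘ[P] E) :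
    Integrable (fun x => dist (f x) (g x) / (1 + dist (f x) (g x))) P := by
  have hm : AEMeasurable (fun x => dist (f x) (g x)) P :=
    (f.aestronglyMeasurable.dist g.aestronglyMeasurable).aemeasurable
  refine Integrable.of_bound (hm.div (hm.const_add 1)).aestronglyMeasurable 1
    (Eventually.of_forall fun x => ?_)
  have h := dist_nonneg (x := f x) (y := g x)
  rw [Real.norm_of_nonneg (by positivity), div_le_one (by positivity)]
  linarith

/-- The metric `d_ℙ(h,g) = ∫ d(h,g) / (1 + d(h,g)) dℙ` of convergence in probability. -/
noncomputable instance : MetricSpace (LZero P E) where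
  dist (f g : Ω →ₘ[P] E) := ∫ x, dist (f x) (g x) / (1 + dist (f x) (g x)) ∂P
  dist_self (f : Ω →ₘ[P] E) := by simp
  dist_comm (f g : Ω →ₘ[P] E) := by simp only [dist_comm]
  dist_triangle (f g h : Ω →ₘ[P] E) := by
    rw [← integral_add (integrable_dist_div f g) (integrable_dist_div g h)]
    refine integral_mono (integrable_dist_div f h)
      ((integrable_dist_div f g).add (integrable_dist_div g h)) fun x => ?_
    have h1 := dist_nonneg (x := f x) (y := g x)
    have h2 := dist_nonneg (x := g x) (y := h x)
    have h3 := dist_nonneg (x := f x) (y := h x)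
    have h4 := dist_triangle (f x) (g x) (h x)
    set a := dist (f x) (g x)
    set b := dist (g x) (h x)
    set c := dist (f x) (h x)
    have e1 : c / (1 + c) ≤ (a + b) / (1 + (a + b)) := by
      rw [div_le_div_iff₀ (by positivity) (by positivity)]
      nlinarith
    have e2 : a / (1 + (a + b)) ≤ a / (1 + a) := by gcongr; linarith
    have e3 : b / (1 + (a + b)) ≤ b / (1 + b) := by gcongr; linarith
    rw [add_div] at e1
    exact e1.trans (add_le_add e2 e3)
  eq_of_dist_eq_zero {f g} h := by
    change Ω →ₘ[P] E at f g
    have h0 : ∀ x, 0 ≤ dist (f x) (g x) / (1 + dist (f x) (g x)) := fun x => by positivity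
    have h1 := (integral_eq_zero_iff_of_nonneg h0 (integrable_dist_div f g)).1 h
    refine AEEqFun.ext (h1.mono fun x hx => ?_)
    have h2 : 0 < 1 + dist (f x) (g x) := by positivity
    exact dist_eq_zero.1 ((div_eq_zero_iff.1 hx).resolve_right h2.ne')

end LZero

section Harmonic

/-- The space `H(T,E)` of generalized harmonic functions, with the topology of pointwise
convergence inherited from the product `E^T`. -/
def harmonic {T : RootedTree.{u}} [Branching T] {F : Type*} [Field F] (w : T → T → F)
    (E : Type*) [AddCommGroup E] [Module F E] : Submodule F (T → E) where
  carrier := {f | ∀ x, f x = ∑ y : children x, w x y • f y}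
  zero_mem' := by intro x; simp
  add_mem' := by
    intro f g hf hg x
    simp only [Pi.add_apply, smul_add, Finset.sum_add_distrib]
    rw [← hf x, ← hg x]
  smul_mem' := by
    intro c f hf x
    simp only [Pi.smul_apply, smul_comm _ c]
    rw [← Finset.smul_sum, ← hf x]

variable {T : RootedTree.{u}} [Branching T] {E : Type*}

theorem stronglyMeasurable_eval [TopologicalSpace E] (n : ℕ) (f : T → E) :
    StronglyMeasurable (fun e : Boundary T => f (e n)) := by
  let _ : MeasurableSpace T := ⊤
  have h : Measurable (fun e : Boundary T => e n) := by
    refine measurable_to_countable' fun x => ?_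
    by_cases hx : ∃ e : Boundary T, e n = x
    · obtain ⟨e, rfl⟩ := hx
      convert measurableSet_sector (e n) using 1
      ext e'
      exact (mem_sector_apply e e' n).symm
    · convert MeasurableSet.empty using 1
      ext e'
      simpa using fun h => hx ⟨e', h⟩
  exact (StronglyMeasurable.of_discrete (f := f)).comp_measurable h

/-- `ω_n(f)(e) = f(z)`, where `z` is the vertex of `e` at level `n`, as an element of `L⁰`. -/
noncomputable def omega (q : Transition T) [TopologicalSpace E] (n : ℕ) (f : T → E) :
    LZero (boundaryMeasure q) E :=
  AEEqFun.mk (fun e : Boundary T => f (e n)) (stronglyMeasurable_eval n f).aestronglyMeasurable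

/-- The lower (asymptotic) density `liminf_n #{k ∈ A : k < n} / n` of a set `A ⊆ ℕ`. -/
noncomputable def lowerDensity (A : Set ℕ) : ℝ :=
  liminf (fun n : ℕ => ((A ∩ Set.Iio n).ncard : ℝ) / n) atTop

/-- The class `U_FM^τ(T,E)` of harmonic functions that are frequently universal along the
levels `n_0 < n_1 < n_2 < …` of an infinite set `τ ⊆ ℕ`; here `n_k = Nat.nth (· ∈ τ) k`. -/
def freqUniversal {F : Type*} [Field F] (w : T → T → F) (q : Transition T)
    (E : Type*) [AddCommGroup E] [Module F E] [MetricSpace E] (τ : Set ℕ) :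
    Set (harmonic w E) :=
  {f | ∀ V : Set (LZero (boundaryMeasure q) E), IsOpen V → V.Nonempty →
    0 < lowerDensity {k | omega q (Nat.nth (· ∈ τ) k) (f : T → E) ∈ V}}

end Harmonic

end HarmonicTree

/-! Choose at every vertex a distinguished child `star x` of transition probability at most 1/2.
Given targets `b x`, a harmonic function can be steered: every child other than `star x` receives
exactly `b x`, and the starred child absorbs the error, which is possible because its weight is
invertible. Since the weights at `x` sum to 1, a vertex already carrying the value `b x` passes it
on to all its children. Hence, if the target is constant along a path during j + 1 consecutive
levels, the function has reached it at the end unless the path took the starred child every time, an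
event of probability at most 2^-(j+1).

The levels are cut into blocks by the ruler sequence. A block with label j has at least j + 1 levels
and ends at a level of τ, and the blocks with a given label end at a set of indices of positive
lower density (`exists_labelling`). Each label is assigned one of countably many tasks: an index i,
a level m and a finitely supported code for a function of level m with values in a dense sequence of
E. Every task receives arbitrarily large labels. During a block the function of the task's index i
aims at the coded function, and all the other functions aim at 0.

The functions are indexed by i = (a, N), where f_(a, N) copies the a-th member of a dense sequence
of harmonic functions up to level N and is steered afterwards (`exists_harmonic_extension`). Letting
N grow shows that their span is dense. In a non-zero combination, pick an index with coefficient c ≠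
0: at the ends of its blocks the other terms vanish off a small set, so c times the coded function
remains. These multiples approximate every element of L⁰, which gives universality with positive
lower density. -/

namespace HarmonicTree
universe u

/-! ### Lower density and the labelling of levels by the ruler sequence -/

section Density

/-- Linear growth of `κ` puts the distinct points `κ u` with `K ≤ u < n / C` below `n`, which bounds
the counting function from below by `n / C - K`. -/
theorem lowerDensity_pos_of_strictMono {A : Set ℕ} {κ : ℕ → ℕ} (hκ : StrictMono κ) {C K : ℕ}
    (hC : ∀ u, κ u < C * (u + 1)) (hA : ∀ u, K ≤ u → κ u ∈ A) : 0 < lowerDensity A := by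
  have hC0 : 0 < C := by
    have := hC 0
    by_contra h
    simp [Nat.eq_zero_of_not_pos h] at this
  have hCR : (0 : ℝ) < C := by exact_mod_cast hC0
  have hcard : ∀ n : ℕ, n / C - K ≤ (A ∩ Set.Iio n).ncard := by
    intro n
    have hsub : κ '' (Set.Ico K (n / C)) ⊆ A ∩ Set.Iio n := by
      rintro _ ⟨u, ⟨hu1, hu2⟩, rfl⟩
      refine ⟨hA u hu1, lt_of_lt_of_le (hC u) ?_⟩
      exact (Nat.mul_le_mul_left C hu2).trans (Nat.mul_div_le n C)
    have h := Set.ncard_le_ncard hsub ((Set.finite_Iio n).inter_of_right A)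
    rw [Set.ncard_image_of_injective _ hκ.injective] at h
    simpa [← Finset.coe_Ico, Set.ncard_coe_finset] using h
  have hle : ∀ n : ℕ, ((A ∩ Set.Iio n).ncard : ℝ) / n ≤ 1 := by
    intro n
    have h := Set.ncard_le_ncard (Set.inter_subset_right : A ∩ Set.Iio n ⊆ Set.Iio n)
      (Set.finite_Iio n)
    have h' : (Set.Iio n).ncard = n := by
      rw [← Finset.coe_Iio, Set.ncard_coe_finset, Nat.card_Iio]
    rw [h'] at h
    exact div_le_one_of_le₀ (by exact_mod_cast h) (Nat.cast_nonneg n)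
  have hbdd : IsBoundedUnder (· ≤ ·) atTop
      (fun n : ℕ => ((A ∩ Set.Iio n).ncard : ℝ) / n) :=
    isBoundedUnder_of ⟨1, hle⟩
  -- Half of the density `1 / C` is given up to absorb the loss of `K + 1` points once `n ≥ 2 * C *
  -- (K + 1)`.
  have key : 1 / (2 * (C : ℝ)) ≤ lowerDensity A := by
    refine le_liminf_of_le hbdd.isCoboundedUnder_ge ?_
    filter_upwards [eventually_ge_atTop (2 * C * (K + 1))] with n hn
    have hnR : (2 * C * (K + 1) : ℝ) ≤ n := by exact_mod_cast hn
    have hn0 : (0 : ℝ) < n := lt_of_lt_of_le (by positivity) hnR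
    have h1 : (n : ℝ) ≤ C * ((A ∩ Set.Iio n).ncard + K + 1) := by
      have h2 : n < C * (n / C + 1) := Nat.lt_mul_div_succ n hC0
      have h3 : n / C + 1 ≤ (A ∩ Set.Iio n).ncard + K + 1 := by
        have := hcard n
        omega
      exact_mod_cast h2.le.trans (Nat.mul_le_mul_left C h3)
    rw [div_le_div_iff₀ (by positivity) hn0]
    nlinarith
  exact lt_of_lt_of_le (by positivity) key

/-- The end points of consecutive blocks whose lengths follow the ruler sequence. -/
noncomputable def rulerSum (r : ℕ) : ℕ := r + padicValNat 2 r.factorial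

theorem rulerSum_succ (r : ℕ) :
    rulerSum (r + 1) = rulerSum r + (padicValNat 2 (r + 1) + 1) := by
  rw [rulerSum, rulerSum, Nat.factorial_succ, padicValNat.mul (by omega) r.factorial_ne_zero]
  omega

theorem rulerSum_strictMono : StrictMono rulerSum :=
  strictMono_nat_of_lt_succ fun r => by rw [rulerSum_succ]; omega

/-- Legendre's formula gives v_2(r!) ≤ r. The block lengths are unbounded, yet their sum grows
linearly; this is what makes the densities positive. -/
theorem rulerSum_le (r : ℕ) : rulerSum r ≤ 2 * r := by
  have := sub_one_mul_padicValNat_factorial (p := 2) r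
  unfold rulerSum
  omega

theorem padicValNat_two_pow_mul_odd (j u : ℕ) : padicValNat 2 (2 ^ j * (2 * u + 1)) = j := by
  rw [padicValNat.mul (by positivity) (by omega), padicValNat.prime_pow,
    padicValNat.eq_zero_of_not_dvd (by omega), add_zero]

/-- The levels can be labelled in such a way that, for every label `j`, the levels `n_k` that are
preceded by a run of `j + 1` labels `j` have positive lower density in `τ`. -/
theorem exists_labelling {τ : Set ℕ} (hτ : τ.Infinite) : ∃ J : ℕ → ℕ, ∀ j K : ℕ,
    ∀ A : Set ℕ, (∀ k a, K ≤ a → a + (j + 1) = Nat.nth (· ∈ τ) k →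
      (∀ l, a ≤ l → l < a + (j + 1) → J l = j) → k ∈ A) → 0 < lowerDensity A := by
  classical
  have hn : StrictMono (Nat.nth (· ∈ τ)) := Nat.nth_strictMono hτ
  set ν := Nat.nth (· ∈ τ) with hν
  have ht : StrictMono (fun r => ν (rulerSum r)) := hn.comp rulerSum_strictMono
  have hex : ∀ l, ∃ r, l < ν (rulerSum r) := fun l => ⟨l + 1, Nat.lt_of_lt_of_le
    (Nat.lt_succ_self l) (ht.le_apply (x := l + 1))⟩
  have hadd : ∀ a d, ν a + d ≤ ν (a + d) := by
    intro a d
    induction d with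
    | zero => exact le_rfl
    | succ d ih =>
      have := hn (Nat.lt_succ_self (a + d))
      rw [← add_assoc]
      exact Nat.succ_le_of_lt (lt_of_le_of_lt ih this)
  -- A level in the block [ν(rulerSum r), ν(rulerSum (r + 1))) is labelled v_2(r + 1). Label `j`
  -- thus occurs for r + 1 = 2^j (2u + 1), and the admissible indices are k = rulerSum (r + 1).
  refine ⟨fun l => padicValNat 2 (Nat.find (hex l)), fun j K A hA => ?_⟩
  have hm : StrictMono fun u => 2 ^ j * (2 * u + 1) := fun a b hab => by
    have : 0 < 2 ^ j := by positivity
    exact Nat.mul_lt_mul_of_pos_left (by omega) this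
  refine lowerDensity_pos_of_strictMono (rulerSum_strictMono.comp hm) (C := 2 ^ (j + 2)) (K := K)
    (fun u => ?_) fun u hu => ?_
  · refine lt_of_le_of_lt (rulerSum_le _) ?_
    have : 0 < 2 ^ j := by positivity
    rw [pow_succ, pow_succ]
    nlinarith
  · obtain ⟨r, hr⟩ : ∃ r, 2 ^ j * (2 * u + 1) = r + 1 :=
      ⟨_, (Nat.succ_pred_eq_of_pos (by positivity)).symm⟩
    have hv : padicValNat 2 (r + 1) = j := by rw [← hr, padicValNat_two_pow_mul_odd]
    have hs : rulerSum (r + 1) = rulerSum r + (j + 1) := by rw [rulerSum_succ, hv]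
    have hru : u ≤ r := by
      have : 0 < 2 ^ j := by positivity
      nlinarith
    -- Gaps in τ only lengthen a block, so its last `j + 1` levels lie inside it.
    have h1 := hadd (rulerSum r) (j + 1)
    rw [← hs] at h1
    have h2 : r ≤ ν (rulerSum r) := ht.le_apply
    have h3 : ν (rulerSum (r + 1)) - (j + 1) + (j + 1) = ν (rulerSum (r + 1)) := by omega
    refine hA _ (ν (rulerSum (r + 1)) - (j + 1)) (by omega) (by simp only [Function.comp, hr, h3])
      fun l hl1 hl2 => ?_
    have : Nat.find (hex l) = r + 1 := by
      rw [Nat.find_eq_iff]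
      refine ⟨by omega, fun r' hr' => ?_⟩
      have := ht.monotone (Nat.le_of_lt_succ hr')
      omega
    simp only [this, hv]

/-- Each task must recur at arbitrarily large labels, since the label controls the exceptional
probability. -/
theorem exists_seq_frequently_eq (Θ : Type*) [Countable Θ] [Nonempty Θ] :
    ∃ σ : ℕ → Θ, ∀ θ J, ∃ j ≥ J, σ j = θ := by
  obtain ⟨σ, hσ⟩ := exists_surjective_nat Θ
  refine ⟨fun j => σ j.unpair.1, fun θ J => ?_⟩
  obtain ⟨a, rfl⟩ := hσ θ
  exact ⟨Nat.pair a J, Nat.right_le_pair a J, by simp⟩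

end Density

/-! ### Recursion along paths and the probability of following the starred children -/

section Paths

variable {T : RootedTree.{u}}

theorem exists_boundary_apply_succ_eq [Branching T] {x y : T} (h : y ∈ children x) :
    ∃ (e : Boundary T) (n : ℕ), e n = x ∧ e (n + 1) = y := by
  obtain ⟨e, m, rfl⟩ := exists_boundary_apply_eq y
  cases m with
  | zero =>
    have := h.lt
    rw [e.2.1] at this
    exact absurd this not_lt_bot
  | succ n =>
    refine ⟨e, n, ?_, rfl⟩
    rw [← Order.pred_eq_of_covBy (e.2.2 n), ← Order.pred_eq_of_covBy h]

/-- The length of the path from the root to `x`. -/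
noncomputable def height [Branching T] (x : T) : ℕ := (exists_boundary_apply_eq x).choose_spec.choose

/-- The ancestor at level `m` of a vertex `x` of height at least `m`. -/
noncomputable def ancestor [Branching T] (m : ℕ) (x : T) : T := (exists_boundary_apply_eq x).choose m

theorem height_apply [Branching T] (e : Boundary T) (n : ℕ) : height (e n) = n :=
  (eq_of_apply_eq _ e _ n (exists_boundary_apply_eq (e n)).choose_spec.choose_spec).1

theorem ancestor_apply [Branching T] (e : Boundary T) {m n : ℕ} (h : m ≤ n) :
    ancestor m (e n) = e m := by
  have := (eq_of_apply_eq _ e _ n (exists_boundary_apply_eq (e n)).choose_spec.choose_spec).2 m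
  exact this (h.trans_eq (height_apply e n).symm)

/-- Each vertex determines its path from the root, so a value can be propagated level by level from
parent to child. -/
theorem exists_recursion [Branching T] {X : Type*} (x₀ : X) (step : T → T → X → X) :
    ∃ f : T → X, f ⊥ = x₀ ∧
      ∀ (e : Boundary T) n, f (e (n + 1)) = step (e n) (e (n + 1)) (f (e n)) := by
  let val : ℕ → T → X := fun n => Nat.rec (fun _ => x₀)
    (fun m v y => step (ancestor m y) y (v (ancestor m y))) n
  refine ⟨fun x => val (height x) x, ?_, fun e n => ?_⟩
  · obtain ⟨e, -, -⟩ := exists_boundary_apply_eq (⊥ : T)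
    have := height_apply e 0
    rw [e.2.1] at this
    simp only [this]
    rfl
  · simp only [height_apply]
    change step (ancestor n (e (n + 1))) _ (val n (ancestor n (e (n + 1)))) = _
    rw [ancestor_apply e (Nat.le_succ n)]

theorem exists_child_prob_le_half [Branching T] (q : Transition T) (x : T) :
    ∃ y ∈ children x, q.prob x y ≤ 1 / 2 := by
  classical
  obtain ⟨y, z, hy, hz, hyz⟩ := Set.one_lt_encard_iff.1
    (lt_of_lt_of_le (by norm_num) (Branching.two_le_children x))
  by_contra! h
  have h1 := h y hy
  have h2 := h z hz
  have hne : (⟨y, hy⟩ : children x) ≠ ⟨z, hz⟩ := fun h => hyz (congrArg Subtype.val h)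
  have h3 : q.prob x y + q.prob x z ≤ 1 := by
    rw [← q.sum_eq_one x, ← Finset.sum_pair hne (f := fun y : children x => q.prob x y)]
    exact Finset.sum_le_sum_of_subset (Finset.subset_univ _)
  have h4 : (1 : ℝ≥0) < q.prob x y + q.prob x z := by
    calc (1 : ℝ≥0) = 1 / 2 + 1 / 2 := (add_halves 1).symm
      _ < _ := add_lt_add h1 h2
  exact absurd h3 (not_le.2 h4)

theorem cylinder_eq_biUnion (m : ℕ) (S : Set T) :
    {e : Boundary T | e m ∈ S} = ⋃ x ∈ {x ∈ S | ∃ e : Boundary T, e m = x}, sector x := by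
  ext e
  simp only [Set.mem_ofPred_eq, Set.mem_iUnion, exists_prop]
  constructor
  · exact fun h => ⟨e m, ⟨h, e, rfl⟩, m, rfl⟩
  · rintro ⟨_, ⟨hx, e', rfl⟩, he⟩
    rwa [(mem_sector_apply e' e m).1 he]

theorem measurableSet_cylinder [Branching T] (m : ℕ) (S : Set T) :
    MeasurableSet {e : Boundary T | e m ∈ S} := by
  rw [cylinder_eq_biUnion]
  exact MeasurableSet.biUnion (Set.to_countable _) fun x _ => measurableSet_sector x

/-- Following a child of probability at most `1/2` halves the measure of a cylinder. -/
theorem boundaryMeasure_step_le [Branching T] (q : Transition T) {star : T → T}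
    (hs : ∀ x, star x ∈ children x) (hq : ∀ x, q.prob x (star x) ≤ 1 / 2) (n : ℕ) (S : Set T) :
    boundaryMeasure q {e | e n ∈ S ∧ e (n + 1) = star (e n)} ≤
      2⁻¹ * boundaryMeasure q {e | e n ∈ S} := by
  set R : Set T := {x ∈ S | ∃ e : Boundary T, e n = x}
  have h1 : {e : Boundary T | e n ∈ S} = ⋃ x ∈ R, sector x := cylinder_eq_biUnion n S
  have h2 : {e : Boundary T | e n ∈ S ∧ e (n + 1) = star (e n)} ⊆ ⋃ x ∈ R, sector (star x) := by
    rintro e ⟨he, he'⟩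
    exact Set.mem_biUnion (show e n ∈ R from ⟨he, e, rfl⟩) ⟨n + 1, he'⟩
  have hR : R.Countable := Set.to_countable _
  have hd : R.PairwiseDisjoint (sector : T → Set (Boundary T)) := by
    rintro _ ⟨-, e, rfl⟩ _ ⟨-, e', rfl⟩ hne
    refine Set.disjoint_left.2 fun e'' h h' => hne ?_
    rw [← (mem_sector_apply e e'' n).1 h, (mem_sector_apply e' e'' n).1 h']
  rw [h1, measure_biUnion hR hd fun x _ => measurableSet_sector x, ← ENNReal.tsum_mul_left]
  refine (measure_mono h2).trans ((measure_biUnion_le _ hR _).trans (ENNReal.tsum_le_tsum ?_))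
  rintro ⟨_, -, e, rfl⟩
  obtain ⟨e', m, hm, hm'⟩ := exists_boundary_apply_succ_eq (hs (e n))
  have h3 := boundaryMeasure_sector q e' (m + 1)
  rw [Finset.prod_range_succ, ← boundaryMeasure_sector, hm, hm'] at h3
  simp only [h3]
  rw [mul_comm]
  gcongr
  have := ENNReal.coe_le_coe.2 (hq (e n))
  simpa using this

/-- Whether the first `j` steps were all starred is determined by the vertex at level `a + j`; the
event is a cylinder, and one more starred step halves its measure. -/
theorem boundaryMeasure_run_le [Branching T] (q : Transition T) {star : T → T}
    (hs : ∀ x, star x ∈ children x) (hq : ∀ x, q.prob x (star x) ≤ 1 / 2) (a j : ℕ) :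
    boundaryMeasure q {e | ∀ l, a ≤ l → l < a + j → e (l + 1) = star (e l)} ≤ 2⁻¹ ^ j := by
  induction j with
  | zero => simpa using prob_le_one
  | succ j ih =>
    set D : Set (Boundary T) := {e | ∀ l, a ≤ l → l < a + j → e (l + 1) = star (e l)}
    have hD : D = {e : Boundary T | e (a + j) ∈ (fun e : Boundary T => e (a + j)) '' D} := by
      ext e
      refine ⟨fun h => ⟨e, h, rfl⟩, ?_⟩
      rintro ⟨e', h', he⟩ l h1 h2
      have h3 := (eq_of_apply_eq e' e (a + j) (a + j) he).2
      rw [← h3 l h2.le, ← h3 (l + 1) h2]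
      exact h' l h1 h2
    have h := boundaryMeasure_step_le q hs hq (a + j) ((fun e : Boundary T => e (a + j)) '' D)
    rw [← hD] at h
    calc _ ≤ _ := measure_mono ?_
      _ ≤ _ := h
      _ ≤ _ := by rw [pow_succ']; gcongr
    intro e he
    have hmem : e ∈ D := fun l h1 h2 => he l h1 (by omega)
    exact ⟨⟨e, hmem, rfl⟩, he (a + j) (by omega) (by omega)⟩

/-- The first disjunct of `hf` makes `f` hit `v` at a non-starred step; the second keeps it there
while the target stays `v`. -/
theorem apply_eq_of_exists_ne_star {E : Type*} {star : T → T} {f b : T → E} {N : ℕ} {e : Boundary T}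
    (hf : ∀ n, N ≤ n → ((e (n + 1) ≠ star (e n) ∨ f (e n) = b (e n)) → f (e (n + 1)) = b (e n)))
    {a j : ℕ} (ha : N ≤ a) {v : E} (hb : ∀ l, a ≤ l → l < a + j → b (e l) = v)
    (he : ¬ ∀ l, a ≤ l → l < a + j → e (l + 1) = star (e l)) : f (e (a + j)) = v := by
  push Not at he
  obtain ⟨l, hl1, hl2, hl⟩ := he
  have key : ∀ d, l + 1 + d ≤ a + j → f (e (l + 1 + d)) = v := by
    intro d
    induction d with
    | zero =>
      intro _
      rw [add_zero, hf l (by omega) (Or.inl hl), hb l hl1 hl2]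
    | succ d ih =>
      intro hd
      have hbv := hb (l + 1 + d) (by omega) (by omega)
      rw [← add_assoc, hf (l + 1 + d) (by omega) (Or.inr ((ih (by omega)).trans hbv.symm)), hbv]
  have := key (a + j - (l + 1)) (by omega)
  rwa [show l + 1 + (a + j - (l + 1)) = a + j by omega] at this

end Paths

/-! ### Steered harmonic functions -/

section Construction

variable {T : RootedTree.{u}} [Branching T] {F : Type*} [Field F] {E : Type*} [AddCommGroup E]
  [Module F E]

/-- A harmonic function that coincides with `g` up to level `N` and then, from every vertex `x`,
takes the value `b x` at all children except at the child `star x`. -/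
theorem exists_harmonic_extension {w : T → T → F} (hw : ∀ x, ∀ y ∈ children x, w x y ≠ 0)
    (hw1 : ∀ x, ∑ y : children x, w x y = 1) {star : T → T} (hs : ∀ x, star x ∈ children x)
    (g : harmonic w E) (N : ℕ) (b : T → E) :
    ∃ f : harmonic w E, (∀ (e : Boundary T) n, n ≤ N → (f : T → E) (e n) = (g : T → E) (e n)) ∧
      ∀ (e : Boundary T) n, N ≤ n → ((e (n + 1) ≠ star (e n) ∨ (f : T → E) (e n) = b (e n)) →
        (f : T → E) (e (n + 1)) = b (e n)) := by
  classical
  -- With `v` the value at `x`, the weighted sum over the children is `b x + (v - b x) = v`. If `v =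
  -- b x`, the correction vanishes and the starred child also receives `b x`.
  obtain ⟨f, hf0, hf⟩ := exists_recursion (T := T) ((g : T → E) ⊥) fun x y v =>
    if height x < N then (g : T → E) y else
      b x + if y = star x then (w x y)⁻¹ • (v - b x) else 0
  have hlow : ∀ (e : Boundary T) n, n ≤ N → f (e n) = (g : T → E) (e n) := by
    intro e n hn
    cases n with
    | zero => rw [e.2.1, hf0]
    | succ n => rw [hf, height_apply, if_pos (by omega)]
  refine ⟨⟨f, fun x => ?_⟩, hlow, fun e n hn h => ?_⟩
  · obtain ⟨e, n, rfl⟩ := exists_boundary_apply_eq x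
    rcases lt_or_ge n N with h | h
    · rw [hlow e n h.le, g.2 (e n)]
      refine Finset.sum_congr rfl fun y _ => ?_
      obtain ⟨e', m, hm, hm'⟩ := exists_boundary_apply_succ_eq y.2
      obtain ⟨rfl, -⟩ := eq_of_apply_eq e' e m n hm
      rw [← hm', hlow e' (m + 1) h]
    · have hy : ∀ y : children (e n), w (e n) y • f y = w (e n) y • b (e n) +
          if y = ⟨star (e n), hs (e n)⟩ then f (e n) - b (e n) else 0 := by
        intro y
        obtain ⟨e', m, hm, hm'⟩ := exists_boundary_apply_succ_eq y.2
        obtain ⟨rfl, -⟩ := eq_of_apply_eq e' e m n hm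
        have := hf e' m
        rw [hm, hm', height_apply, if_neg (by omega)] at this
        rw [this, smul_add]
        congr 1
        simp only [Subtype.ext_iff]
        split_ifs with h
        · rw [smul_smul, mul_inv_cancel₀ (hw _ _ y.2), one_smul]
        · exact smul_zero _
      simp only [hy, Finset.sum_add_distrib, ← Finset.sum_smul, hw1, one_smul,
        Finset.sum_ite_eq', Finset.mem_univ, if_true]
      exact (add_sub_cancel _ _).symm
  · change f (e (n + 1)) = _
    rw [hf, height_apply, if_neg (by omega)]
    rcases h with h | h
    · rw [if_neg h, add_zero]
    · rw [show f (e n) = b (e n) from h]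
      simp

end Construction

/-! ### Approximation in probability by functions of a single level -/

section Approximation

/-- The class in `L⁰` of a measurable function. -/
def LZero.mk {Ω : Type*} [MeasurableSpace Ω] {P : Measure Ω} {E : Type*} [TopologicalSpace E]
    (f : Ω → E) (hf : AEStronglyMeasurable f P) : LZero P E := AEEqFun.mk f hf

theorem LZero.exists_eq_mk {Ω : Type*} [MeasurableSpace Ω] {P : Measure Ω} {E : Type*}
    [TopologicalSpace E] (h : LZero P E) : ∃ (f : Ω → E) (hf : StronglyMeasurable f),
      h = LZero.mk f hf.aestronglyMeasurable := by
  change Ω →ₘ[P] E at h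
  exact ⟨h, h.stronglyMeasurable, (AEEqFun.mk_coeFn h).symm⟩

/-- The integrand d / (1 + d) is at most 1 on `B` and at most `η` off it. `B` need not be
measurable, hence the measurable hull in the proof. -/
theorem LZero.dist_mk_le {Ω : Type*} [MeasurableSpace Ω] {P : Measure Ω}
    [IsProbabilityMeasure P] {E : Type*} [MetricSpace E] {f g : Ω → E}
    (hf : AEStronglyMeasurable f P) (hg : AEStronglyMeasurable g P) {B : Set Ω} {η δ : ℝ}
    (hη : 0 ≤ η) (hδ : 0 ≤ δ) (hB : P B ≤ ENNReal.ofReal δ) (h : ∀ x ∉ B, dist (f x) (g x) ≤ η) :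
    dist (LZero.mk f hf) (LZero.mk g hg) ≤ η + δ := by
  set B' := toMeasurable P B
  have hm : MeasurableSet B' := measurableSet_toMeasurable P B
  have hi : Integrable (fun x => η + B'.indicator (fun _ => (1 : ℝ)) x) P :=
    (integrable_const η).add ((integrable_const 1).indicator hm)
  calc dist (LZero.mk f hf) (LZero.mk g hg)
      ≤ ∫ x, (η + B'.indicator (fun _ => (1 : ℝ)) x) ∂P := by
        refine integral_mono_ae (integrable_dist_div _ _) hi ?_
        filter_upwards [AEEqFun.coeFn_mk f hf, AEEqFun.coeFn_mk g hg] with x hx hy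
        change dist (AEEqFun.mk f hf x) (AEEqFun.mk g hg x) /
          (1 + dist (AEEqFun.mk f hf x) (AEEqFun.mk g hg x)) ≤ _
        rw [hx, hy]
        have hn := dist_nonneg (x := f x) (y := g x)
        by_cases hxB : x ∈ B'
        · rw [Set.indicator_of_mem hxB]
          refine (div_le_one_of_le₀ (by linarith) (by positivity)).trans (by linarith)
        · rw [Set.indicator_of_notMem hxB, add_zero]
          refine le_trans (div_le_self hn (by linarith)) (h x fun hx => hxB ?_)
          exact subset_toMeasurable P B hx
    _ = η + P.real B' := by
        rw [integral_add (integrable_const η) ((integrable_const 1).indicator hm),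
          integral_indicator_const _ hm]
        simp
    _ ≤ η + δ := by
        gcongr
        rw [measureReal_def, measure_toMeasurable]
        exact ENNReal.toReal_le_of_le_ofReal hδ hB

variable {T : RootedTree.{u}}

theorem apply_mem_level (e : Boundary T) (n : ℕ) : e n ∈ level T n := by
  induction n with
  | zero => exact e.2.1
  | succ n ih => exact ⟨e n, ih, e.2.2 n⟩

variable [Branching T]

theorem cylinder_eq_of_le {X : Type*} {m n : ℕ} (h : m ≤ n) (φ : T → X) (e : Boundary T) :
    φ (e m) = (φ ∘ ancestor m) (e n) := by
  rw [Function.comp, ancestor_apply e h]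

/-- Sets depending on one level form an algebra, because two such sets can both be read off at the
larger level; this algebra generates the σ-algebra of the sectors. -/
theorem measureDense_cylinder (P : Measure (Boundary T)) [IsFiniteMeasure P] :
    P.MeasureDense {C | ∃ (m : ℕ) (S : Set T), C = {e : Boundary T | e m ∈ S}} := by
  refine Measure.MeasureDense.of_generateFrom_isSetAlgebra_finite (μ := P)
    (IsSetAlgebra.mk ⟨0, ∅, rfl⟩ ?_ ?_) ?_
  · rintro _ ⟨m, S, rfl⟩
    exact ⟨m, Sᶜ, rfl⟩
  · rintro _ _ ⟨m, S, rfl⟩ ⟨n, R, rfl⟩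
    refine ⟨max m n, {x | ancestor m x ∈ S ∨ ancestor n x ∈ R}, ?_⟩
    ext e
    simp [ancestor_apply e (le_max_left m n), ancestor_apply e (le_max_right m n)]
  · refine le_antisymm (MeasurableSpace.generateFrom_mono ?_) (MeasurableSpace.generateFrom_le ?_)
    · rintro _ ⟨x, rfl⟩
      obtain ⟨e, n, rfl⟩ := exists_boundary_apply_eq x
      refine ⟨n, {e n}, ?_⟩
      ext e'
      exact mem_sector_apply e e' n
    · rintro _ ⟨m, S, rfl⟩
      exact measurableSet_cylinder m S

/-- Simple functions on the boundary are approximated in measure by functions of a single level. -/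
theorem SimpleFunc.exists_cylinder_approx {E : Type*} [AddCommGroup E] (P : Measure (Boundary T)) [IsFiniteMeasure P] (f : SimpleFunc (Boundary T) E) :
    ∀ ε : ℝ, 0 < ε → ∃ (m : ℕ) (φ : T → E), P {e | f e ≠ φ (e m)} ≤ ENNReal.ofReal ε := by
  classical
  induction f using SimpleFunc.induction with
  | @const c s hs =>
    intro ε hε
    obtain ⟨_, ⟨m, S, rfl⟩, hS⟩ :=
      (measureDense_cylinder P).approx s hs (measure_ne_top P s) ε hε
    refine ⟨m, fun x => if x ∈ S then c else 0, (measure_mono ?_).trans hS.le⟩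
    intro e he
    simp only [SimpleFunc.coe_piecewise, SimpleFunc.coe_const, Set.piecewise,
      Function.const_apply, Set.mem_ofPred_eq] at he
    rw [Set.mem_symmDiff, Set.mem_ofPred_eq]
    by_cases h1 : e ∈ s <;> by_cases h2 : e m ∈ S <;> simp_all
  | @add f g _ hf hg =>
    intro ε hε
    obtain ⟨m, φ, hφ⟩ := hf (ε / 2) (half_pos hε)
    obtain ⟨n, ψ, hψ⟩ := hg (ε / 2) (half_pos hε)
    refine ⟨max m n, φ ∘ ancestor m + ψ ∘ ancestor n, ?_⟩
    have hsub : {e | (f + g) e ≠ (φ ∘ ancestor m + ψ ∘ ancestor n) (e (max m n))} ⊆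
        {e | f e ≠ φ (e m)} ∪ {e | g e ≠ ψ (e n)} := by
      intro e he
      by_contra hcon
      simp only [Set.mem_union, Set.mem_ofPred_eq, not_or, not_not] at hcon
      refine he ?_
      rw [Pi.add_apply, ← cylinder_eq_of_le (le_max_left m n),
        ← cylinder_eq_of_le (le_max_right m n), SimpleFunc.add_apply, hcon.1, hcon.2]
    calc _ ≤ _ := (measure_mono hsub).trans (measure_union_le _ _)
      _ ≤ _ := add_le_add hφ hψ
      _ = ENNReal.ofReal ε := by
        rw [← ENNReal.ofReal_add (half_pos hε).le (half_pos hε).le, add_halves]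

/-- Simple functions approximate in measure, and single-level functions approximate simple
functions. -/
theorem exists_omega_mem {E : Type*} [AddCommGroup E] [MetricSpace E] (q : Transition T)
    {V : Set (LZero (boundaryMeasure q) E)} (hV : IsOpen V) (hne : V.Nonempty) :
    ∃ (m : ℕ) (φ : T → E), omega q m φ ∈ V := by
  obtain ⟨h, hh⟩ := hne
  obtain ⟨ε, hε, hball⟩ := Metric.isOpen_iff.1 hV h hh
  obtain ⟨h, hsm, rfl⟩ := LZero.exists_eq_mk h
  have ht := tendstoInMeasure_of_tendsto_ae (μ := boundaryMeasure q)
    (fun n => (hsm.approx n).stronglyMeasurable.aestronglyMeasurable)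
    (Eventually.of_forall hsm.tendsto_approx)
  have h1 := ht (ENNReal.ofReal (ε / 4)) (ENNReal.ofReal_pos.2 (by positivity))
  obtain ⟨n, hn⟩ := (h1.eventually_lt_const (u := ENNReal.ofReal (ε / 4))
    (ENNReal.ofReal_pos.2 (by positivity))).exists
  obtain ⟨m, φ, hφ⟩ := SimpleFunc.exists_cylinder_approx (boundaryMeasure q) (hsm.approx n)
    (ε / 4) (by positivity)
  refine ⟨m, φ, hball ?_⟩
  rw [Metric.mem_ball]
  have key := LZero.dist_mk_le (P := boundaryMeasure q) (f := fun e => φ (e m)) (g := h)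
    (stronglyMeasurable_eval m φ).aestronglyMeasurable hsm.aestronglyMeasurable
    (B := {e | ENNReal.ofReal (ε / 4) ≤ edist (hsm.approx n e) (h e)} ∪
      {e | hsm.approx n e ≠ φ (e m)}) (η := ε / 4) (δ := ε / 4 + ε / 4) (by positivity)
    (by positivity) ?_ ?_
  · exact lt_of_le_of_lt key (by linarith)
  · rw [ENNReal.ofReal_add (by positivity) (by positivity)]
    exact (measure_union_le _ _).trans (add_le_add hn.le hφ)
  · intro e he
    simp only [Set.mem_union, Set.mem_ofPred_eq, not_or, not_le, not_not] at he
    rw [← he.2]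
    have := he.1
    rw [edist_dist] at this
    exact ((ENNReal.ofReal_lt_ofReal_iff (by positivity)).1 this).le

end Approximation

/-! ### Open sets of L⁰ tested on countably many codes -/

section Universality

variable {T : RootedTree.{u}} [Branching T] {F : Type*} [Field F]

/-- Open sets of `L⁰` contain multiples of functions of a single level with values in a given dense
sequence, together with all functions that agree with them off a set of small measure. -/
theorem exists_cylinder_forall_mem [TopologicalSpace F] {E : Type*} [AddCommGroup E] [Module F E]
    [MetricSpace E] [ContinuousSMul F E]
    (q : Transition T) {D : ℕ → E}
    (hD : DenseRange D) {c : F} (hc : c ≠ 0)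
    {V : Set (LZero (boundaryMeasure q) E)} (hV : IsOpen V) (hne : V.Nonempty) :
    ∃ (m : ℕ) (p : T →₀ ℕ) (J : ℕ), ∀ j ≥ J, ∀ (n : ℕ) (f : T → E) (B : Set (Boundary T)),
      boundaryMeasure q B ≤ 2⁻¹ ^ j → (∀ e ∉ B, f (e n) = c • D (p (e m))) → omega q n f ∈ V := by
  classical
  obtain ⟨m, φ, hφ⟩ := exists_omega_mem q hV hne
  obtain ⟨ε, hε, hball⟩ := Metric.isOpen_iff.1 hV _ hφ
  have hcD : DenseRange fun i => c • D i := by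
    refine DenseRange.comp (g := fun v : E => c • v) (f := D) ?_ hD (continuous_const_smul c)
    exact Function.Surjective.denseRange fun v => ⟨c⁻¹ • v, smul_inv_smul₀ hc v⟩
  have hex : ∀ x, ∃ i, dist (φ x) (c • D i) < ε / 2 := fun x => hcD.exists_dist_lt _ (half_pos hε)
  choose p hp using hex
  have hfin : (Set.range fun e : Boundary T => e m).Finite :=
    (Branching.finite_level m).subset (Set.range_subset_iff.2 fun e => apply_mem_level e m)
  obtain ⟨J, hJ⟩ := exists_pow_lt_of_lt_one (half_pos hε) (by norm_num : (2⁻¹ : ℝ) < 1)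
  -- Only the finitely many vertices of level `m` matter; cutting `p` off elsewhere makes it
  -- finitely supported, so that the codes form a countable set.
  refine ⟨m, Finsupp.onFinset hfin.toFinset (fun x => if x ∈ hfin.toFinset then p x else 0)
    (fun x hx => by by_contra h; simp [h] at hx), J, fun j hj n f B hB hf => hball ?_⟩
  rw [Metric.mem_ball]
  refine lt_of_le_of_lt (LZero.dist_mk_le (η := ε / 2) (δ := 2⁻¹ ^ j) _ _ (by positivity) (by positivity)
    (B := B) (hB.trans_eq ?_) fun e he => ?_) ?_
  · rw [ENNReal.ofReal_pow (by norm_num), ENNReal.ofReal_inv_of_pos (by norm_num)]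
    norm_num
  · rw [hf e he, Finsupp.onFinset_apply, if_pos (by simp), dist_comm]
    exact (hp _).le
  · have : (2⁻¹ : ℝ) ^ j ≤ 2⁻¹ ^ J := pow_le_pow_of_le_one (by norm_num) (by norm_num) hj
    linarith

end Universality

end HarmonicTree

/-! ### The dense subspace -/

open HarmonicTree in
theorem theorem5p4 {F : Type*} [Field F] [TopologicalSpace F] [T2Space F] [ContinuousAdd F]
    [ContinuousInv₀ F]
    {E : Type*} [AddCommGroup E] [Module F E] [MetricSpace E] [TopologicalSpace.SeparableSpace E]
    [ContinuousSMul F E] (hd : ∀ a b c : E, dist (a + c) (b + c) = dist a b)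
    (T : RootedTree) [HarmonicTree.Branching T]
    (w : T → T → F) (hw : ∀ x, ∀ y ∈ HarmonicTree.children x, w x y ≠ 0)
    (hw1 : ∀ x, ∑ y : HarmonicTree.children x, w x y = 1)
    (q : HarmonicTree.Transition T) (τ : Set ℕ) (hτ : τ.Infinite) :
    ∃ A : Submodule F (HarmonicTree.harmonic w E),
      Dense (A : Set (HarmonicTree.harmonic w E)) ∧
      (A : Set (HarmonicTree.harmonic w E)) ⊆ HarmonicTree.freqUniversal w q E τ ∪ {0} := by
  classical
  choose star hs hq using exists_child_prob_le_half q
  obtain ⟨label, hlabel⟩ := exists_labelling hτ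
  obtain ⟨task, htask⟩ := exists_seq_frequently_eq ((ℕ × ℕ) × ℕ × (T →₀ ℕ))
  have : SecondCountableTopology E := UniformSpace.secondCountable_of_separable E
  have : SecondCountableTopology (harmonic w E) :=
    Topology.IsEmbedding.subtypeVal.secondCountableTopology
  let D : ℕ → E := TopologicalSpace.denseSeq E
  let G : ℕ → harmonic w E := TopologicalSpace.denseSeq (harmonic w E)
  -- Target 0 whenever the current task belongs to another index: this isolates one term of a linear
  -- combination.
  let b : ℕ × ℕ → T → E := fun i x =>
    if (task (label (height x))).1 = i then
      D ((task (label (height x))).2.2 (ancestor (task (label (height x))).2.1 x)) else 0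
  choose f hf1 hf2 using fun i : ℕ × ℕ =>
    exists_harmonic_extension hw hw1 hs (G i.1) i.2 (b i)
  refine ⟨Submodule.span F (Set.range f), ?_, ?_⟩
  · have hsub : Set.range G ⊆ closure (Submodule.span F (Set.range f) : Set (harmonic w E)) := by
      rintro _ ⟨a, rfl⟩
      -- At each vertex the sequence in `N` is eventually constant, equal to the value of `G a`.
      refine mem_closure_of_tendsto (f := fun N => f (a, N)) (b := atTop) ?_
        (Eventually.of_forall fun N => Submodule.subset_span ⟨_, rfl⟩)
      rw [tendsto_subtype_rng, tendsto_pi_nhds]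
      intro x
      obtain ⟨e, n, rfl⟩ := exists_boundary_apply_eq x
      refine tendsto_const_nhds.congr' ?_
      filter_upwards [eventually_ge_atTop n] with N hN
      exact (hf1 (a, N) e n hN).symm
    rw [dense_iff_closure_eq]
    exact Set.eq_univ_of_univ_subset
      ((TopologicalSpace.denseRange_denseSeq (harmonic w E)).closure_eq ▸
        closure_minimal hsub isClosed_closure)
  · intro x hx
    obtain ⟨c, rfl⟩ := Finsupp.mem_span_range_iff_exists_finsupp.1 hx
    by_cases hc0 : c = 0
    · right
      simp [hc0]
    obtain ⟨i₀, hi₀⟩ := Finsupp.ne_iff.1 hc0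
    left
    intro V hV hne
    obtain ⟨m, p, J, hmem⟩ := exists_cylinder_forall_mem q
      (TopologicalSpace.denseRange_denseSeq E) hi₀ hV hne
    obtain ⟨j, hj, hjt⟩ := htask (i₀, m, p) J
    -- The run must start beyond level `m`, where the coded function is already determined, and
    -- beyond every `N` in the support, where all the functions involved are being steered.
    refine hlabel j (max m (c.support.sup Prod.snd)) _ fun k a ha hak hl => ?_
    refine hmem (j + 1) (by omega) _ _ _ (boundaryMeasure_run_le q hs hq a (j + 1)) fun e he => ?_
    have hval : ∀ i ∈ c.support, (f i : T → E) (e (Nat.nth (· ∈ τ) k)) =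
        if i = i₀ then D (p (e m)) else 0 := by
      intro i hi
      rw [← hak]
      refine apply_eq_of_exists_ne_star (hf2 i e) (a := a) ?_ (fun l h1 h2 => ?_) he
      · exact ((Finset.le_sup (f := Prod.snd) hi).trans (le_max_right _ _)).trans ha
      · simp only [b, height_apply, hl l h1 h2, hjt,
          ancestor_apply e (((le_max_left _ _).trans ha).trans h1), eq_comm]
    rw [Finsupp.sum, Submodule.coe_sum, Finset.sum_apply, Finset.sum_eq_single i₀]
    · rw [Submodule.coe_smul, Pi.smul_apply, hval i₀ (Finsupp.mem_support_iff.2 hi₀), if_pos rfl]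
    · intro i hi hne
      rw [Submodule.coe_smul, Pi.smul_apply, hval i hi, if_neg hne, smul_zero]
    · intro h
      simp [Finsupp.notMem_support_iff.1 h]
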